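/- **Setting.** Let $P$ be a topological space, $n,l\in\mathbb N$, $g\colon P\times\mathbb R^n\to\mathbb R^l$, $C\subset\mathbb R^l$, $\Gamma(p):=\{x\in\mathbb R^n\mid g(p,x)\in C\}$, and let $(\bar p,\bar x)$ satisfy $g(\bar p,\bar x)\in C$. Assume that $C$ is locally closed around $g(\bar p,\bar x)$ (its intersection with some neighborhood of this point is closed), that there are neighborhoods $U$ of $\bar x$ and $V$ of $\bar p$ such that $g(p,\cdot)$ is continuously differentiable on $U$ for each $p\in V$, and that $g$ and $\nabla_x g$ are continuous at $(\bar p,\bar x)$. Norms are Euclidean, distances to sets take values in $[0,\infty]$ with $\mathrm{dist}(x;\emptyset)=\infty$, $\mathbb B$ is the closed unit ball, and $\inf\emptyset=\infty$. **Normal cones.** For $\Omega\subset\mathbb R^d$ and $z\in\Omega$ let $T_\Omega(z)$ be the set of all $u$ for which there are $t_k\downarrow0$ and $u_k\to u$ with $z+t_ku_k\in\Omega$ for all $k$; let $\widehat N_\Omega(z):=\{v\mid\langle v,u\rangle\le0\ \text{for all } u\in T_\Omega(z)\}$; and let $N_\Omega(z)$ be the set of all limits $v=\lim_k v_k$ with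 $v_k\in\widehat N_\Omega(z_k)$, $z_k\in\Omega$, $z_k\to z$. **Metric subregularity.** A set-valued mapping $F$ is metrically subregular at $(z,y)$ if there are $\kappa\ge0$ and a neighborhood of $z$ on which $\mathrm{dist}(\xi;F^{-1}(y))\le\kappa\,\mathrm{dist}(y;F(\xi))$. **Properties of the system $g(p,x)\in C$ at $(\bar p,\bar x)$.** * *Robinson stability (RS)* holds with modulus $\kappa\ge0$ if there are neighborhoods $U$ of $\bar x$ and $V$ of $\bar p$ such that $\mathrm{dist}(x;\Gamma(p))\le\kappa\,\mathrm{dist}(g(p,x);C)$ for all $(p,x)\in V\times U$. The infimum of all such moduli is the RS exact bound $\mathrm{subreg}_x(g,C)(\bar p,\bar x)$. * $\bar x$ is a *parametrically stable solution* at $\bar p$ if for every neighborhood $U$ of $\bar x$ there is a neighborhood $V$ of $\bar p$ with $\Gamma(p)\cap U\neq\emptyset$ for all $p\in V$. * The *partial MSCQ* holds if there are neighborhoods $U$ of $\bar x$ and $V$ of $\bar p$ such that for all $p\in V$ and $x\in\Gamma(p)\cap U$ the mapping $\xi\mapsto g(p,\xi)-C$ is metrically subregular at $(x,0)$. * The *partial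 bounded multiplier property (BMP)* holds with modulus $\kappa\ge0$ if there are neighborhoods $V$ of $\bar p$ and $U$ of $\bar x$ such that for all $p\in V$, $x\in\Gamma(p)\cap U$ and $v\in N_{\Gamma(p)}(x)$ there is $\lambda\in N_C(g(p,x))\cap\kappa\|v\|\mathbb B$ with $\nabla_xg(p,x)^*\lambda=v$. The infimum of all such moduli is the BMP exact bound $\mathrm{bmp}_x(g,C)(\bar p,\bar x)$. RS and the partial BMP are said to hold if they hold with some modulus $\kappa\ge0$. **Subamenability.** $C$ is subamenable at $\bar z\in C$ if there are $d\in\mathbb N$, an open neighborhood $W$ of $\bar z$, a $\mathcal C^1$ mapping $q\colon W\to\mathbb R^d$ and a closed convex set $Q\subset\mathbb R^d$ such that $C\cap W=\{z\in W\mid q(z)\in Q\}$ and $z\mapsto q(z)-Q$ is metrically subregular at $(\bar z,0)$. **Theorem 3.3 (first-order relationships for Robinson stability).** Consider the statements (i) Robinson stability holds at $(\bar p,\bar x)$; (ii) $\bar x$ is a parametrically stable solution at $\bar p$, and both the partial MSCQ and the partial BMP hold at $(\bar p,\bar x)$. Then (i) implies (ii), and in this case $\mathrm{bmp}_x(g,C)(\bar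 p,\bar x)\le\mathrm{subreg}_x(g,C)(\bar p,\bar x)$. Conversely, if $C$ is subamenable at $g(\bar p,\bar x)$, then (ii) implies (i), and in this case $\mathrm{subreg}_x(g,C)(\bar p,\bar x)=\mathrm{bmp}_x(g,C)(\bar p,\bar x)$. -/

import Mathlib

open Filter Metric
open scoped Topology NNReal ENNReal

namespace RobinsonStability

section NormalCones

variable {E : Type*} [NormedAddCommGroup E] [InnerProductSpace ℝ E]

/-- A set is locally closed around `z` if its intersection with some neighborhood of `z` is
closed. -/
def LocallyClosedAround (Ω : Set E) (z : E) : Prop :=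
  ∃ W ∈ 𝓝 z, IsClosed (Ω ∩ W)

/-- The (Bouligand-Severi) contingent cone to `Ω` at `z`. -/
def contingentCone (Ω : Set E) (z : E) : Set E :=
  {u | ∃ (t : ℕ → ℝ) (w : ℕ → E), (∀ k, 0 < t k) ∧ Tendsto t atTop (𝓝 0) ∧
    Tendsto w atTop (𝓝 u) ∧ ∀ k, z + t k • w k ∈ Ω}

/-- The (Fréchet) regular normal cone to `Ω` at `z`: the polar of the contingent cone. -/
def regularNormalCone (Ω : Set E) (z : E) : Set E :=
  {v | ∀ u ∈ contingentCone Ω z, inner ℝ v u ≤ 0}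

/-- The (Mordukhovich) limiting normal cone to `Ω` at `z`. -/
def limitingNormalCone (Ω : Set E) (z : E) : Set E :=
  {v | ∃ (ζ w : ℕ → E), Tendsto ζ atTop (𝓝 z) ∧ Tendsto w atTop (𝓝 v) ∧
    ∀ k, ζ k ∈ Ω ∧ w k ∈ regularNormalCone Ω (ζ k)}

end NormalCones

section Subregularity

/-- Metric subregularity of the set-valued mapping `F` at `(z, y)`. The distance to a set takes
values in `[0, ∞]`, and the distance to the empty set is `∞`. -/
def MetricallySubregularAt {X Y : Type*} [PseudoEMetricSpace X] [PseudoEMetricSpace Y]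
    (F : X → Set Y) (z : X) (y : Y) : Prop :=
  ∃ κ : ℝ≥0, ∃ U ∈ 𝓝 z, ∀ ξ ∈ U, infEDist ξ {ζ | y ∈ F ζ} ≤ κ * infEDist y (F ξ)

/-- Subamenability of `C ⊆ ℝˡ` at `z ∈ C`. The mapping `z ↦ q z - Q` lives on the open
neighborhood `W` of `z`: it has empty values outside `W`, where `q` is irrelevant. -/
def SubamenableAt {l : ℕ} (C : Set (EuclideanSpace ℝ (Fin l)))
    (z : EuclideanSpace ℝ (Fin l)) : Prop :=
  z ∈ C ∧ ∃ (d : ℕ) (W : Set (EuclideanSpace ℝ (Fin l)))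
    (q : EuclideanSpace ℝ (Fin l) → EuclideanSpace ℝ (Fin d))
    (Q : Set (EuclideanSpace ℝ (Fin d))),
    IsOpen W ∧ z ∈ W ∧ ContDiffOn ℝ 1 q W ∧ IsClosed Q ∧ Convex ℝ Q ∧
    C ∩ W = {ζ ∈ W | q ζ ∈ Q} ∧
    MetricallySubregularAt (fun ζ => {y | ζ ∈ W ∧ ∃ c ∈ Q, y = q ζ - c}) z 0

end Subregularity

section ParametricConstraintSystem

variable {P : Type*} [TopologicalSpace P] {n l : ℕ}

/-- The solution map `Γ` of the parametric constraint system `g p x ∈ C`. -/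
def solutionMap (g : P → EuclideanSpace ℝ (Fin n) → EuclideanSpace ℝ (Fin l))
    (C : Set (EuclideanSpace ℝ (Fin l))) (p : P) : Set (EuclideanSpace ℝ (Fin n)) :=
  {x | g p x ∈ C}

/-- Smoothness assumptions on `g` around the reference point: for `p` near `p₀` the mapping
`g p` is continuously differentiable on a common neighborhood of `x₀`, and both `g` and its
partial derivative in `x` are (jointly) continuous at `(p₀, x₀)`. -/
structure StandingAssumptions
    (g : P → EuclideanSpace ℝ (Fin n) → EuclideanSpace ℝ (Fin l))
    (p₀ : P) (x₀ : EuclideanSpace ℝ (Fin n)) : Prop where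
  contDiff_near : ∃ V ∈ 𝓝 p₀, ∃ U : Set (EuclideanSpace ℝ (Fin n)), IsOpen U ∧ x₀ ∈ U ∧
    ∀ p ∈ V, ContDiffOn ℝ 1 (g p) U
  continuousAt_map :
    ContinuousAt (fun z : P × EuclideanSpace ℝ (Fin n) => g z.1 z.2) (p₀, x₀)
  continuousAt_deriv :
    ContinuousAt (fun z : P × EuclideanSpace ℝ (Fin n) => fderiv ℝ (g z.1) z.2) (p₀, x₀)

/-- Robinson stability at `(p₀, x₀)` with modulus `κ`. -/
def RobinsonStableWith
    (g : P → EuclideanSpace ℝ (Fin n) → EuclideanSpace ℝ (Fin l))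
    (C : Set (EuclideanSpace ℝ (Fin l))) (p₀ : P) (x₀ : EuclideanSpace ℝ (Fin n))
    (κ : ℝ≥0) : Prop :=
  ∃ U ∈ 𝓝 x₀, ∃ V ∈ 𝓝 p₀, ∀ p ∈ V, ∀ x ∈ U,
    infEDist x (solutionMap g C p) ≤ κ * infEDist (g p x) C

/-- Robinson stability at `(p₀, x₀)`. -/
def RobinsonStable
    (g : P → EuclideanSpace ℝ (Fin n) → EuclideanSpace ℝ (Fin l))
    (C : Set (EuclideanSpace ℝ (Fin l))) (p₀ : P) (x₀ : EuclideanSpace ℝ (Fin n)) : Prop :=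
  ∃ κ : ℝ≥0, RobinsonStableWith g C p₀ x₀ κ

/-- The exact bound of Robinson stability: the infimum of all moduli (`∞` if there are none). -/
noncomputable def subregBound
    (g : P → EuclideanSpace ℝ (Fin n) → EuclideanSpace ℝ (Fin l))
    (C : Set (EuclideanSpace ℝ (Fin l))) (p₀ : P) (x₀ : EuclideanSpace ℝ (Fin n)) : ℝ≥0∞ :=
  ⨅ (κ : ℝ≥0) (_ : RobinsonStableWith g C p₀ x₀ κ), (κ : ℝ≥0∞)

/-- `x₀` is a parametrically stable solution at `p₀`. -/
def ParametricallyStable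
    (g : P → EuclideanSpace ℝ (Fin n) → EuclideanSpace ℝ (Fin l))
    (C : Set (EuclideanSpace ℝ (Fin l))) (p₀ : P) (x₀ : EuclideanSpace ℝ (Fin n)) : Prop :=
  ∀ U ∈ 𝓝 x₀, ∃ V ∈ 𝓝 p₀, ∀ p ∈ V, (solutionMap g C p ∩ U).Nonempty

/-- The partial metric subregularity constraint qualification: for all feasible `(p, x)` near
`(p₀, x₀)` the mapping `ξ ↦ g p ξ - C` is metrically subregular at `(x, 0)`. -/
def PartialMSCQ
    (g : P → EuclideanSpace ℝ (Fin n) → EuclideanSpace ℝ (Fin l))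
    (C : Set (EuclideanSpace ℝ (Fin l))) (p₀ : P) (x₀ : EuclideanSpace ℝ (Fin n)) : Prop :=
  ∃ U ∈ 𝓝 x₀, ∃ V ∈ 𝓝 p₀, ∀ p ∈ V, ∀ x ∈ solutionMap g C p ∩ U,
    MetricallySubregularAt (fun ξ => {y | ∃ c ∈ C, y = g p ξ - c}) x 0

/-- The set `Λ(p, x, v)` of multipliers. -/
noncomputable def multipliers
    (g : P → EuclideanSpace ℝ (Fin n) → EuclideanSpace ℝ (Fin l))
    (C : Set (EuclideanSpace ℝ (Fin l))) (p : P) (x v : EuclideanSpace ℝ (Fin n)) :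
    Set (EuclideanSpace ℝ (Fin l)) :=
  {lam ∈ limitingNormalCone C (g p x) |
    ContinuousLinearMap.adjoint (fderiv ℝ (g p) x) lam = v}

/-- The partial bounded multiplier property at `(p₀, x₀)` with modulus `κ`. -/
def PartialBMPWith
    (g : P → EuclideanSpace ℝ (Fin n) → EuclideanSpace ℝ (Fin l))
    (C : Set (EuclideanSpace ℝ (Fin l))) (p₀ : P) (x₀ : EuclideanSpace ℝ (Fin n))
    (κ : ℝ≥0) : Prop :=
  ∃ V ∈ 𝓝 p₀, ∃ U ∈ 𝓝 x₀, ∀ p ∈ V, ∀ x ∈ solutionMap g C p ∩ U,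
    ∀ v ∈ limitingNormalCone (solutionMap g C p) x,
      (multipliers g C p x v ∩ closedBall 0 (κ * ‖v‖)).Nonempty

/-- The partial bounded multiplier property at `(p₀, x₀)`. -/
def PartialBMP
    (g : P → EuclideanSpace ℝ (Fin n) → EuclideanSpace ℝ (Fin l))
    (C : Set (EuclideanSpace ℝ (Fin l))) (p₀ : P) (x₀ : EuclideanSpace ℝ (Fin n)) : Prop :=
  ∃ κ : ℝ≥0, PartialBMPWith g C p₀ x₀ κ

/-- The exact bound of the bounded multiplier property: the infimum of all moduli (`∞` if there
are none). -/
noncomputable def bmpBound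
    (g : P → EuclideanSpace ℝ (Fin n) → EuclideanSpace ℝ (Fin l))
    (C : Set (EuclideanSpace ℝ (Fin l))) (p₀ : P) (x₀ : EuclideanSpace ℝ (Fin n)) : ℝ≥0∞ :=
  ⨅ (κ : ℝ≥0) (_ : PartialBMPWith g C p₀ x₀ κ), (κ : ℝ≥0∞)

end ParametricConstraintSystem

end RobinsonStability

/-! Write f for `g p` with p near `p₀` fixed. The forward direction rests on a multiplier rule,
`exists_multiplier_of_mem_limitingNormalCone`. If dist(y;Ω) ≤ κ dist(f y;C) near x and v is a
regular normal to Ω at x, then x locally minimizes -⟨v,y-x⟩ + ε|y-x| + κ(|v|+ε) dist(f y;C). Replace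
the distance by a smoothed |f y - c| and minimize jointly over y and c ∈ C: stationarity in c gives
a regular normal to C, stationarity in y the adjoint equation. As ε → 0 this yields λ with |λ| ≤
κ|v|; κ is not enlarged, hence the inequality of the exact bounds.

Conversely, let y ∈ Γ(p) be nearest to x. Then x-y is normal to Γ(p), and the BMP gives λ with |λ| ≤
κ|x-y| and |x-y|² = ⟨λ,∇f(y)(x-y)⟩ ≈ ⟨λ,f x-c⟩ + ⟨λ,c-f y⟩ for c ∈ C. By superregularity
(`SubamenableAt.eventually_inner_le`, the same multiplier rule applied to the preimage of the convex
set Q) the last term is at most ε|λ||c-f y|. So |x-y| ≤ κ'|f x-c| for any κ' > κ, which is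
`norm_le_of_multiplier`. -/

namespace RobinsonStability

/-! ### Regular and limiting normals -/

section NormalConeCalculus

variable {E : Type*} [NormedAddCommGroup E] [InnerProductSpace ℝ E]

theorem mem_regularNormalCone_of_forall_eventually_le {Ω : Set E} {z v : E}
    (h : ∀ ε > 0, ∀ᶠ y in 𝓝[Ω] z, inner ℝ v (y - z) ≤ ε * ‖y - z‖) :
    v ∈ regularNormalCone Ω z := by
  rintro u ⟨t, w, ht, ht0, hw, hmem⟩
  have hlim : Tendsto (fun k => z + t k • w k) atTop (𝓝 z) := by
    simpa using tendsto_const_nhds.add (ht0.smul hw)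
  have hlim' : Tendsto (fun k => z + t k • w k) atTop (𝓝[Ω] z) :=
    tendsto_nhdsWithin_iff.2 ⟨hlim, Eventually.of_forall hmem⟩
  have key : ∀ ε > 0, inner ℝ v u ≤ ε * ‖u‖ := by
    intro ε hε
    refine le_of_tendsto_of_tendsto (tendsto_const_nhds.inner hw) (hw.norm.const_mul ε) ?_
    filter_upwards [hlim'.eventually (h ε hε)] with k hk
    rw [add_sub_cancel_left, inner_smul_right, norm_smul, Real.norm_of_nonneg (ht k).le] at hk
    have : t k * inner ℝ v (w k) ≤ t k * (ε * ‖w k‖) := by linarith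
    exact le_of_mul_le_mul_left this (ht k)
  refine le_of_forall_pos_le_add fun η hη => ?_
  have h1 := key (η / (‖u‖ + 1)) (by positivity)
  have h2 : η / (‖u‖ + 1) * ‖u‖ ≤ η := by
    rw [div_mul_eq_mul_div, div_le_iff₀ (by positivity)]
    nlinarith [norm_nonneg u]
  linarith

/-- Points violating the inequality have, by compactness of the unit sphere, a limiting direction u;
it is tangent, yet ⟨v,u⟩ ≥ ε. -/
theorem eventually_inner_le_of_mem_regularNormalCone [FiniteDimensional ℝ E] {Ω : Set E}
    {z v : E} (hv : v ∈ regularNormalCone Ω z) {ε : ℝ} (hε : 0 < ε) :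
    ∀ᶠ y in 𝓝[Ω] z, inner ℝ v (y - z) ≤ ε * ‖y - z‖ := by
  by_contra hcon
  rw [not_eventually] at hcon
  obtain ⟨y, hy, hlt⟩ := exists_seq_forall_of_frequently hcon
  rw [tendsto_nhdsWithin_iff] at hy
  obtain ⟨hy, hmem⟩ := hy
  obtain ⟨N, hN⟩ := eventually_atTop.1 hmem
  have hne : ∀ k, 0 < ‖y k - z‖ := by
    intro k
    rw [norm_pos_iff]
    intro h0
    have := hlt k
    simp [h0] at this
  have hsph : ∀ k, ‖y k - z‖⁻¹ • (y k - z) ∈ sphere (0 : E) 1 := by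
    intro k
    rw [mem_sphere_zero_iff_norm, norm_smul, norm_inv, norm_norm, inv_mul_cancel₀ (hne k).ne']
  obtain ⟨u, -, φ, hφ, hu⟩ := (isCompact_sphere (0 : E) 1).tendsto_subseq hsph
  have hdist : Tendsto (fun k => ‖y k - z‖) atTop (𝓝 0) := by
    simpa using (hy.sub_const z).norm
  -- Membership in Ω holds only from index N on, while the contingent cone asks for it at every
  -- index.
  have hshift : Tendsto (fun k => φ (k + N)) atTop atTop :=
    hφ.tendsto_atTop.comp (tendsto_add_atTop_nat N)
  have hu' : Tendsto (fun k => ‖y (φ (k + N)) - z‖⁻¹ • (y (φ (k + N)) - z)) atTop (𝓝 u) :=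
    hu.comp (tendsto_add_atTop_nat N)
  have h1 : inner ℝ v u ≤ 0 := by
    refine hv u ⟨fun k => ‖y (φ (k + N)) - z‖, _, fun k => hne _, hdist.comp hshift, hu', ?_⟩
    intro k
    rw [smul_inv_smul₀ (hne _).ne', add_sub_cancel]
    exact hN _ ((Nat.le_add_left N k).trans (hφ.id_le _))
  have h2 : ε ≤ inner ℝ v u := by
    refine ge_of_tendsto (tendsto_const_nhds.inner hu') (Eventually.of_forall fun k => ?_)
    have h3 := not_le.1 (hlt (φ (k + N)))
    rw [inner_smul_right, ← div_eq_inv_mul, le_div_iff₀ (hne _)]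
    exact h3.le
  linarith

theorem regularNormalCone_subset_limitingNormalCone {Ω : Set E} {z : E} (hz : z ∈ Ω) :
    regularNormalCone Ω z ⊆ limitingNormalCone Ω z := fun v hv =>
  ⟨fun _ => z, fun _ => v, tendsto_const_nhds, tendsto_const_nhds, fun _ => ⟨hz, hv⟩⟩

theorem limitingNormalCone_closed_graph {Ω : Set E} {z v : E} {ζ w : ℕ → E}
    (hζ : Tendsto ζ atTop (𝓝 z)) (hw : Tendsto w atTop (𝓝 v))
    (h : ∀ k, w k ∈ limitingNormalCone Ω (ζ k)) : v ∈ limitingNormalCone Ω z := by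
  have happrox : ∀ k : ℕ, ∃ y u, dist y (ζ k) < 1 / ((k : ℝ) + 1) ∧
      dist u (w k) < 1 / ((k : ℝ) + 1) ∧ y ∈ Ω ∧ u ∈ regularNormalCone Ω y := by
    intro k
    obtain ⟨y, u, hy, hu, hyu⟩ := h k
    have hpos : 0 < 1 / ((k : ℝ) + 1) := by positivity
    obtain ⟨m, h1, h2⟩ := ((hy.eventually (ball_mem_nhds _ hpos)).and
      (hu.eventually (ball_mem_nhds _ hpos))).exists
    exact ⟨y m, u m, h1, h2, hyu m⟩
  choose y u hy hu hyu using happrox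
  refine ⟨y, u, ?_, ?_, hyu⟩
  · refine hζ.congr_dist (squeeze_zero (fun _ => dist_nonneg) (fun k => ?_)
      tendsto_one_div_add_atTop_nhds_zero_nat)
    rw [dist_comm]
    exact (hy k).le
  · refine hw.congr_dist (squeeze_zero (fun _ => dist_nonneg) (fun k => ?_)
      tendsto_one_div_add_atTop_nhds_zero_nat)
    rw [dist_comm]
    exact (hu k).le

/-- By convexity y - ζ k is tangent at each ζ k; the resulting inequality passes to the limit. -/
theorem inner_le_zero_of_mem_limitingNormalCone_of_convex {Q : Set E} (hQ : Convex ℝ Q)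
    {z v y : E} (hv : v ∈ limitingNormalCone Q z) (hy : y ∈ Q) : inner ℝ v (y - z) ≤ 0 := by
  obtain ⟨ζ, w, hζ, hw, h⟩ := hv
  refine le_of_tendsto (hw.inner (tendsto_const_nhds.sub hζ)) (Eventually.of_forall fun k => ?_)
  refine (h k).2 _ ⟨fun m : ℕ => 1 / ((m : ℝ) + 1), fun _ => y - ζ k, fun m => by positivity,
    tendsto_one_div_add_atTop_nhds_zero_nat, tendsto_const_nhds, fun m => ?_⟩
  refine hQ.add_smul_sub_mem (h k).1 hy ⟨by positivity, ?_⟩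
  rw [div_le_one (by positivity)]
  linarith [(Nat.cast_nonneg m : (0 : ℝ) ≤ m)]

theorem neg_mem_regularNormalCone_of_isLocalMinOn {Ω : Set E} {φ : E → ℝ} {z a : E}
    (hmin : IsLocalMinOn φ Ω z) (hφ : HasFDerivAt φ (innerSL ℝ a) z) :
    -a ∈ regularNormalCone Ω z := by
  refine mem_regularNormalCone_of_forall_eventually_le fun ε hε => ?_
  filter_upwards [hmin, (hφ.isLittleO.def hε).filter_mono nhdsWithin_le_nhds] with y h1 h2
  rw [innerSL_apply_apply, Real.norm_eq_abs] at h2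
  rw [inner_neg_left]
  have h3 := (abs_le.1 h2).2
  have h4 : φ z ≤ φ y := h1
  linarith

theorem sub_mem_regularNormalCone_of_isLocalMinOn_norm {Ω : Set E} {x z : E}
    (hmin : IsLocalMinOn (fun y => ‖x - y‖) Ω z) : x - z ∈ regularNormalCone Ω z := by
  refine mem_regularNormalCone_of_forall_eventually_le fun ε hε => ?_
  filter_upwards [hmin, mem_nhdsWithin_of_mem_nhds (ball_mem_nhds z hε)] with y h1 h2
  rw [mem_ball, dist_eq_norm] at h2
  have h3 : ‖x - z‖ ≤ ‖x - y‖ := h1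
  have h4 : ‖x - y‖ ^ 2 = ‖x - z‖ ^ 2 - 2 * inner ℝ (x - z) (y - z) + ‖y - z‖ ^ 2 := by
    rw [← norm_sub_sq_real, sub_sub_sub_cancel_right]
  have h5 : ‖x - z‖ ^ 2 ≤ ‖x - y‖ ^ 2 := by gcongr
  nlinarith [norm_nonneg (y - z), mul_le_mul_of_nonneg_right h2.le (norm_nonneg (y - z)), mul_nonneg hε.le (norm_nonneg (y - z))]

/-- A one-sided bound suffices: the derivative is linear, so the bound at -d supplies the other sign
at d. -/
theorem norm_le_of_hasFDerivAt_of_eventually_sub_le {φ : E → ℝ} {a z : E} {K : ℝ} (hK : 0 ≤ K)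
    (hφ : HasFDerivAt φ (innerSL ℝ a) z) (h : ∀ᶠ y in 𝓝 z, φ z - φ y ≤ K * ‖y - z‖) :
    ‖a‖ ≤ K := by
  refine le_of_forall_pos_le_add fun η hη => ?_
  rw [← innerSL_apply_norm (𝕜 := ℝ) a]
  refine ContinuousLinearMap.opNorm_le_of_nhds_zero (by positivity) ?_
  have h0 : ∀ᶠ y in 𝓝 z, -(innerSL ℝ a (y - z)) ≤ (K + η) * ‖y - z‖ := by
    filter_upwards [h, hφ.isLittleO.def hη] with y h1 h2
    have h3 := (abs_le.1 h2).2
    linarith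
  have h1 : ∀ᶠ d in 𝓝 (0 : E), -(innerSL ℝ a d) ≤ (K + η) * ‖d‖ := by
    have ht : Tendsto (fun d => z + d) (𝓝 (0 : E)) (𝓝 z) := by
      simpa using (continuous_const_add z).tendsto 0
    filter_upwards [ht.eventually h0] with d hd
    rwa [add_sub_cancel_left] at hd
  have h2 : ∀ᶠ d in 𝓝 (0 : E), innerSL ℝ a d ≤ (K + η) * ‖d‖ := by
    have ht : Tendsto (fun d => -d) (𝓝 (0 : E)) (𝓝 0) := by
      simpa using (continuous_neg (G := E)).tendsto 0
    filter_upwards [ht.eventually h1] with d hd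
    rwa [map_neg, neg_neg, norm_neg] at hd
  filter_upwards [h1, h2] with d hd1 hd2
  exact abs_le.2 ⟨by linarith, hd2⟩

end NormalConeCalculus

/-! ### Locally closed sets -/

section LocallyClosed

variable {E : Type*} [NormedAddCommGroup E]

theorem LocallyClosedAround.eventually {Ω : Set E} {z : E} (h : LocallyClosedAround Ω z) :
    ∀ᶠ y in 𝓝 z, LocallyClosedAround Ω y := by
  obtain ⟨W, hW, hcl⟩ := h
  filter_upwards [eventually_mem_nhds_iff.2 hW] with y hy
  exact ⟨W, hy, hcl⟩

theorem LocallyClosedAround.exists_isCompact_inter_closedBall [ProperSpace E]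
    {Ω : Set E} {z : E} (h : LocallyClosedAround Ω z) :
    ∃ r > 0, IsCompact (Ω ∩ closedBall z r) := by
  obtain ⟨W, hW, hcl⟩ := h
  obtain ⟨r, hr, hrW⟩ := nhds_basis_closedBall.mem_iff.1 hW
  refine ⟨r, hr, ?_⟩
  have : Ω ∩ closedBall z r = closedBall z r ∩ (Ω ∩ W) := by
    ext y
    constructor
    · exact fun hy => ⟨hy.2, hy.1, hrW hy.2⟩
    · exact fun hy => ⟨hy.2.1, hy.1⟩
  rw [this]
  exact (isCompact_closedBall z r).inter_right hcl

end LocallyClosed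

end RobinsonStability
namespace RobinsonStability

/-! ### The smoothed norm -/

section Auxiliary

variable {E F : Type*} [NormedAddCommGroup E] [InnerProductSpace ℝ E]
  [NormedAddCommGroup F] [InnerProductSpace ℝ F]

theorem hasFDerivAt_sqrt_norm_sq_add {y : F} {δ : ℝ} (hδ : 0 < δ) :
    HasFDerivAt (fun y : F => √(‖y‖ ^ 2 + δ ^ 2))
      (innerSL ℝ ((√(‖y‖ ^ 2 + δ ^ 2))⁻¹ • y)) y := by
  have h1 : HasFDerivAt (fun y : F => ‖y‖ ^ 2 + δ ^ 2) (2 • innerSL ℝ y) y :=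
    ((hasStrictFDerivAt_norm_sq y).hasFDerivAt).add_const _
  have h2 := h1.sqrt (by positivity)
  refine h2.congr_fderiv ?_
  ext u
  simp
  ring

theorem norm_inv_sqrt_smul_le (y : F) {δ : ℝ} :
    ‖(√(‖y‖ ^ 2 + δ ^ 2))⁻¹ • y‖ ≤ 1 := by
  have h : ‖y‖ ≤ √(‖y‖ ^ 2 + δ ^ 2) := Real.le_sqrt_of_sq_le (by nlinarith [sq_nonneg δ])
  rw [norm_smul, norm_inv, Real.norm_of_nonneg (Real.sqrt_nonneg _), ← div_eq_inv_mul]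
  exact div_le_one_of_le₀ h (Real.sqrt_nonneg _)

theorem tendsto_clm_apply {ι : Type*} {a : Filter ι} {T : ι → F →L[ℝ] E} {T₀ : F →L[ℝ] E}
    {u : ι → F} {u₀ : F} (hT : Tendsto T a (𝓝 T₀)) (hu : Tendsto u a (𝓝 u₀)) :
    Tendsto (fun i => T i (u i)) a (𝓝 (T₀ u₀)) :=
  (isBoundedBilinearMap_apply.continuous.tendsto (T₀, u₀)).comp (hT.prodMk_nhds hu)

end Auxiliary

/-! ### The multiplier rule under metric subregularity -/

section Multipliers

variable {E F : Type*} [NormedAddCommGroup E] [InnerProductSpace ℝ E] [FiniteDimensional ℝ E]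
  [NormedAddCommGroup F] [InnerProductSpace ℝ F] [FiniteDimensional ℝ F]

/-- Exact penalization: ε‖y - x‖ - ⟨v, y - x⟩ is nonnegative on Ω near x and has Lipschitz constant
‖v‖ + ε, so passing to an almost nearest point of Ω costs that constant times the distance. -/
theorem eventually_inner_le_add_infDist_of_mem_regularNormalCone {Ω : Set E} {x v : E}
    (hx : x ∈ Ω) (hv : v ∈ regularNormalCone Ω x) {ε : ℝ} (hε : 0 < ε) :
    ∀ᶠ y in 𝓝 x, inner ℝ v (y - x) ≤ ε * ‖y - x‖ + (‖v‖ + ε) * infDist y Ω := by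
  have h := eventually_inner_le_of_mem_regularNormalCone hv hε
  obtain ⟨r, hr, hball⟩ := Metric.mem_nhdsWithin_iff.1 h
  filter_upwards [ball_mem_nhds x (show 0 < r / 3 by positivity)] with y hy
  rw [mem_ball] at hy
  refine le_of_forall_pos_le_add fun η hη => ?_
  set η' := min (r / 3) (η / (‖v‖ + ε)) with hη'
  have hη'pos : 0 < η' := by positivity
  obtain ⟨w, hwΩ, hw⟩ := (infDist_lt_iff ⟨x, hx⟩).1 (lt_add_of_pos_right (infDist y Ω) hη'pos)
  have hinf : infDist y Ω ≤ dist y x := infDist_le_dist_of_mem hx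
  have hwx : dist w x < r := by
    have := dist_triangle_left w x y
    have := min_le_left (r / 3) (η / (‖v‖ + ε))
    linarith
  have h1 : inner ℝ v (w - x) ≤ ε * ‖w - x‖ := hball ⟨hwx, hwΩ⟩
  have h2 : inner ℝ v (y - w) ≤ ‖v‖ * ‖y - w‖ := real_inner_le_norm _ _
  have h3 : inner ℝ v (y - x) = inner ℝ v (w - x) + inner ℝ v (y - w) := by
    rw [← inner_add_right]; congr 1; abel
  have h4 : ‖w - x‖ ≤ ‖y - x‖ + ‖y - w‖ := by
    have := dist_triangle_left w x y
    rw [dist_eq_norm, dist_eq_norm, dist_eq_norm] at this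
    linarith
  have h5 : (‖v‖ + ε) * η' ≤ η := by
    rw [mul_comm, ← le_div_iff₀ (by positivity)]
    exact min_le_right _ _
  rw [dist_eq_norm] at hw
  have h6 : (‖v‖ + ε) * ‖y - w‖ ≤ (‖v‖ + ε) * (infDist y Ω + η') := by gcongr
  have h7 : ε * ‖w - x‖ ≤ ε * (‖y - x‖ + ‖y - w‖) := by gcongr
  linarith

/-- Approximate multipliers obtained from a smoothed exact penalization. -/
theorem exists_approximate_multiplier {Ω : Set E} {C : Set F} {f : E → F} {x v : E} {κ : ℝ}
    (hκ : 0 ≤ κ) (hx : x ∈ Ω) (hfx : f x ∈ C) (hf : ContDiffAt ℝ 1 f x)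
    (hC : LocallyClosedAround C (f x))
    (hsub : ∀ᶠ y in 𝓝 x, infDist y Ω ≤ κ * infDist (f y) C)
    (hv : v ∈ regularNormalCone Ω x) {ε : ℝ} (hε : 0 < ε) :
    ∃ y c μ lam, ‖y - x‖ ≤ ε ∧ ‖c - f x‖ ≤ ε ∧ c ∈ C ∧ lam ∈ regularNormalCone C c ∧
      ‖lam - μ‖ ≤ 2 * ε ∧ ‖μ‖ ≤ κ * (‖v‖ + ε) ∧
      ‖v - ContinuousLinearMap.adjoint (fderiv ℝ f y) μ‖ ≤ 2 * ε := by
  obtain ⟨ρ, hρ, hK⟩ := hC.exists_isCompact_inter_closedBall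
  have hdiff : ∀ᶠ y in 𝓝 x, ContDiffAt ℝ 1 f y := hf.eventually (by simp)
  obtain ⟨r, hr, hball⟩ := nhds_basis_closedBall.eventually_iff.1
    ((eventually_inner_le_add_infDist_of_mem_regularNormalCone hx hv hε).and (hsub.and hdiff))
  set L : ℝ := κ * (‖v‖ + ε) with hL
  have hL0 : 0 ≤ L := by positivity
  -- the smoothing parameter
  set τ : ℝ := min (min r ρ) ε with hτ
  have hτ0 : 0 < τ := by positivity
  have hτr : τ ≤ r := (min_le_left _ _).trans (min_le_left _ _)
  have hτρ : τ ≤ ρ := (min_le_left _ _).trans (min_le_right _ _)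
  have hτε : τ ≤ ε := min_le_right _ _
  -- Below, ε‖y - x‖ + ‖c - f x‖² ≤ L * δ < τ'; the two entries turn this into ‖y - x‖ < τ and ‖c -
  -- f x‖ < τ.
  set τ' : ℝ := min (ε * τ) (τ ^ 2) with hτ'
  have hτ'0 : 0 < τ' := by positivity
  set δ : ℝ := τ' / (2 * (L + 1)) with hδ
  have hδ0 : 0 < δ := by positivity
  have hLδ : L * δ < τ' := by
    rw [hδ, mul_div_assoc', div_lt_iff₀ (by positivity)]
    nlinarith
  let N : F → ℝ := fun w => √(‖w‖ ^ 2 + δ ^ 2)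
  have hN : ∀ w, ‖w‖ ≤ N w := fun w => Real.le_sqrt_of_sq_le (by nlinarith [sq_nonneg δ])
  -- In the factor 2 * ε, one ε is consumed by the penalization inequality and the other holds y
  -- near x; the square holds c near f x.
  let ψ : E × F → ℝ := fun z =>
    -inner ℝ v (z.1 - x) + 2 * ε * ‖z.1 - x‖ + L * N (f z.1 - z.2) + ‖z.2 - f x‖ ^ 2
  have hfc : ContinuousOn f (closedBall x r) := fun y hy =>
    (hball hy).2.2.continuousAt.continuousWithinAt
  have hψc : ContinuousOn ψ (closedBall x r ×ˢ (C ∩ closedBall (f x) ρ)) := by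
    have h1 : ContinuousOn (fun z : E × F => f z.1)
        (closedBall x r ×ˢ (C ∩ closedBall (f x) ρ)) :=
      hfc.comp continuousOn_fst fun z hz => hz.1
    have h2 : Continuous N := by fun_prop
    have h3 : ContinuousOn (fun z : E × F => N (f z.1 - z.2))
        (closedBall x r ×ˢ (C ∩ closedBall (f x) ρ)) :=
      h2.comp_continuousOn (h1.sub continuousOn_snd)
    have h4 : Continuous fun z : E × F => -inner ℝ v (z.1 - x) + 2 * ε * ‖z.1 - x‖ := by
      fun_prop
    have h5 : Continuous fun z : E × F => ‖z.2 - f x‖ ^ 2 := by fun_prop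
    exact (h4.continuousOn.add (h3.const_mul L)).add h5.continuousOn
  obtain ⟨⟨y, c⟩, ⟨hy, hcC, hcρ⟩, hmin⟩ := ((isCompact_closedBall x r).prod hK).exists_isMinOn
    ⟨(x, f x), mem_closedBall_self hr.le, hfx, mem_closedBall_self hρ.le⟩ hψc
  simp only at hy hcC hcρ
  have hψx : ψ (x, f x) = L * δ := by
    simp [ψ, N, Real.sqrt_sq hδ0.le]
  have hle : ψ (y, c) ≤ L * δ := hψx ▸ hmin ⟨mem_closedBall_self hr.le, hfx, mem_closedBall_self hρ.le⟩
  have hpen : inner ℝ v (y - x) ≤ ε * ‖y - x‖ + L * N (f y - c) := by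
    have h1 := (hball hy).1
    have h2 := (hball hy).2.1
    have h3 : infDist (f y) C ≤ N (f y - c) := by
      refine (infDist_le_dist_of_mem hcC).trans ?_
      rw [dist_eq_norm]
      exact hN _
    have h4 : (‖v‖ + ε) * infDist y Ω ≤ (‖v‖ + ε) * (κ * N (f y - c)) := by
      gcongr
      exact h2.trans (by gcongr)
    rw [hL]
    linarith
  have hloc : ε * ‖y - x‖ + ‖c - f x‖ ^ 2 ≤ L * δ := by
    simp only [ψ] at hle
    linarith
  have hyτ : ‖y - x‖ < τ := by
    have : ε * ‖y - x‖ < ε * τ := by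
      have := min_le_left (ε * τ) (τ ^ 2)
      nlinarith [sq_nonneg ‖c - f x‖]
    exact lt_of_mul_lt_mul_left this hε.le
  have hcτ : ‖c - f x‖ < τ := by
    refine lt_of_pow_lt_pow_left₀ 2 hτ0.le ?_
    have := min_le_right (ε * τ) (τ ^ 2)
    nlinarith [mul_nonneg hε.le (norm_nonneg (y - x))]
  set e : F := (√(‖f y - c‖ ^ 2 + δ ^ 2))⁻¹ • (f y - c) with he
  have hNd : HasFDerivAt N (innerSL ℝ e) (f y - c) := hasFDerivAt_sqrt_norm_sq_add hδ0
  have hfd : HasFDerivAt f (fderiv ℝ f y) y :=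
    ((hball hy).2.2.differentiableAt (by simp)).hasFDerivAt
  refine ⟨y, c, L • e, L • e - (2 : ℝ) • (c - f x), hyτ.le.trans hτε, hcτ.le.trans hτε, hcC,
    ?_, ?_, ?_, ?_⟩
  -- Stationarity in c. The strict bound by τ makes the ball constraint inactive.
  · have hd : HasFDerivAt (fun w => L * N (f y - w) + ‖w - f x‖ ^ 2)
        (innerSL ℝ (-(L • e - (2 : ℝ) • (c - f x)))) c := by
      have h1 : HasFDerivAt (fun w => f y - w) (-ContinuousLinearMap.id ℝ F) c :=
        (hasFDerivAt_id c).const_sub (f y)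
      have h2 := (hNd.comp c h1).const_mul L
      have h3 : HasFDerivAt (fun w => w - f x) (ContinuousLinearMap.id ℝ F) c :=
        (hasFDerivAt_id c).sub_const (f x)
      refine (h2.add h3.norm_sq).congr_fderiv ?_
      ext u
      simp
      ring
    have hm : IsLocalMinOn (fun w => L * N (f y - w) + ‖w - f x‖ ^ 2) C c := by
      have hnhds : closedBall (f x) ρ ∈ 𝓝 c := by
        refine closedBall_mem_nhds_of_mem ?_
        rw [mem_ball, dist_eq_norm]
        exact hcτ.trans_le hτρ
      filter_upwards [self_mem_nhdsWithin, mem_nhdsWithin_of_mem_nhds hnhds] with w hw1 hw2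
      have h1 : ψ (y, c) ≤ ψ (y, w) := hmin ⟨hy, hw1, hw2⟩
      simp only [ψ] at h1
      linarith
    simpa using neg_mem_regularNormalCone_of_isLocalMinOn hm hd
  · rw [sub_sub_cancel_left, norm_neg, norm_smul, Real.norm_ofNat]
    linarith
  · rw [norm_smul, Real.norm_of_nonneg hL0]
    exact mul_le_of_le_one_right hL0 (norm_inv_sqrt_smul_le _)
  · rw [← norm_neg, neg_sub]
    -- Stationarity in y. The nonsmooth term 2ε‖w - x‖ is left out; being 2ε-Lipschitz, it accounts
    -- for the error 2ε.
    have hd : HasFDerivAt (fun w => L * N (f w - c) - inner ℝ v (w - x))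
        (innerSL ℝ (ContinuousLinearMap.adjoint (fderiv ℝ f y) (L • e) - v)) y := by
      have h1 : HasFDerivAt (fun w => f w - c) (fderiv ℝ f y) y := hfd.sub_const c
      have h2 : HasFDerivAt (fun w => N (f w - c)) _ y := HasFDerivAt.comp (g := N) y hNd h1
      have h4 : HasFDerivAt (fun w => inner ℝ v (w - x)) (innerSL ℝ v) y := by
        simpa [inner_sub_right] using ((innerSL ℝ v).hasFDerivAt (x := y)).sub_const (inner ℝ v x)
      refine ((h2.const_mul L).sub h4).congr_fderiv ?_
      ext u
      simp [ContinuousLinearMap.adjoint_inner_left]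
    refine norm_le_of_hasFDerivAt_of_eventually_sub_le (by positivity) hd ?_
    have hnhds : closedBall x r ∈ 𝓝 y := by
      refine closedBall_mem_nhds_of_mem ?_
      rw [mem_ball, dist_eq_norm]
      exact hyτ.trans_le hτr
    filter_upwards [hnhds] with w hw
    have h1 : ψ (y, c) ≤ ψ (w, c) := hmin ⟨hw, hcC, hcρ⟩
    simp only [ψ] at h1
    have h2 : ‖w - x‖ ≤ ‖w - y‖ + ‖y - x‖ := norm_sub_le_norm_sub_add_norm_sub w y x
    have h3 : 2 * ε * ‖w - x‖ ≤ 2 * ε * (‖w - y‖ + ‖y - x‖) := by gcongr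
    linarith

theorem exists_multiplier_of_mem_regularNormalCone {Ω : Set E} {C : Set F} {f : E → F}
    {x v : E} {κ : ℝ} (hκ : 0 ≤ κ) (hx : x ∈ Ω) (hfx : f x ∈ C) (hf : ContDiffAt ℝ 1 f x)
    (hC : LocallyClosedAround C (f x))
    (hsub : ∀ᶠ y in 𝓝 x, infDist y Ω ≤ κ * infDist (f y) C)
    (hv : v ∈ regularNormalCone Ω x) :
    ∃ lam ∈ limitingNormalCone C (f x),
      ContinuousLinearMap.adjoint (fderiv ℝ f x) lam = v ∧ ‖lam‖ ≤ κ * ‖v‖ := by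
  let ε : ℕ → ℝ := fun k => 1 / ((k : ℝ) + 1)
  have hε0 : ∀ k, 0 < ε k := fun k => by positivity
  have hε1 : ∀ k, ε k ≤ 1 := fun k => by
    rw [div_le_one (by positivity)]
    linarith [(Nat.cast_nonneg k : (0 : ℝ) ≤ k)]
  have hεlim : Tendsto ε atTop (𝓝 0) := tendsto_one_div_add_atTop_nhds_zero_nat
  choose y c μ lam hy hc hcC hlam hlamμ hμ hvμ using fun k =>
    exists_approximate_multiplier hκ hx hfx hf hC hsub hv (hε0 k)
  have hylim : Tendsto y atTop (𝓝 x) :=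
    tendsto_iff_norm_sub_tendsto_zero.2 (squeeze_zero (fun _ => norm_nonneg _) hy hεlim)
  have hclim : Tendsto c atTop (𝓝 (f x)) :=
    tendsto_iff_norm_sub_tendsto_zero.2 (squeeze_zero (fun _ => norm_nonneg _) hc hεlim)
  obtain ⟨μ₀, -, φ, hφ, hμ₀⟩ := (isCompact_closedBall (0 : F) (κ * (‖v‖ + 1))).tendsto_subseq
    (x := μ) (fun k => by
      rw [mem_closedBall_zero_iff]
      exact (hμ k).trans (by gcongr; exact hε1 k))
  have hφ' := hφ.tendsto_atTop
  have h2ε : Tendsto (fun k => 2 * ε k) atTop (𝓝 0) := by simpa using hεlim.const_mul 2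
  have hdiff : Tendsto (fun k => lam k - μ k) atTop (𝓝 0) :=
    tendsto_zero_iff_norm_tendsto_zero.2 (squeeze_zero (fun _ => norm_nonneg _) hlamμ h2ε)
  have hlamlim : Tendsto (fun k => lam (φ k)) atTop (𝓝 μ₀) := by
    simpa using (hdiff.comp hφ').add hμ₀
  have hD : Tendsto (fun k => ContinuousLinearMap.adjoint (fderiv ℝ f (y (φ k)))) atTop
      (𝓝 (ContinuousLinearMap.adjoint (fderiv ℝ f x))) := by
    have h1 : ContinuousAt (fderiv ℝ f) x := (hf.fderiv_right (m := 0) (by simp)).continuousAt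
    exact (ContinuousLinearMap.adjoint.continuous.tendsto _).comp
      (h1.tendsto.comp (hylim.comp hφ'))
  refine ⟨μ₀, ⟨fun k => c (φ k), fun k => lam (φ k), hclim.comp hφ', hlamlim,
    fun k => ⟨hcC _, hlam _⟩⟩, ?_, ?_⟩
  · have h1 : Tendsto (fun k => v - ContinuousLinearMap.adjoint (fderiv ℝ f (y (φ k))) (μ (φ k)))
        atTop (𝓝 (v - ContinuousLinearMap.adjoint (fderiv ℝ f x) μ₀)) :=
      tendsto_const_nhds.sub (tendsto_clm_apply hD hμ₀)
    have h2 : Tendsto (fun k => v - ContinuousLinearMap.adjoint (fderiv ℝ f (y (φ k))) (μ (φ k)))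
        atTop (𝓝 0) :=
      tendsto_zero_iff_norm_tendsto_zero.2
        (squeeze_zero (fun _ => norm_nonneg _) (fun k => hvμ (φ k)) (h2ε.comp hφ'))
    exact (sub_eq_zero.1 (tendsto_nhds_unique h1 h2)).symm
  · have h1 : Tendsto (fun k => κ * (‖v‖ + ε (φ k))) atTop (𝓝 (κ * ‖v‖)) := by
      simpa using ((hεlim.comp hφ').const_add ‖v‖).const_mul κ
    exact le_of_tendsto_of_tendsto' hμ₀.norm h1 fun k => hμ (φ k)

/-- The hypotheses persist at nearby points with the same κ, so multipliers of nearby regular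
normals stay bounded and a subsequence converges. Having f map Ω into C only near x allows for local
representations of Ω. -/
theorem exists_multiplier_of_mem_limitingNormalCone {Ω : Set E} {C : Set F} {f : E → F}
    {x v : E} {κ : ℝ} (hκ : 0 ≤ κ) (hf : ContDiffAt ℝ 1 f x)
    (hΩ : ∀ᶠ y in 𝓝 x, y ∈ Ω → f y ∈ C)
    (hC : LocallyClosedAround C (f x))
    (hsub : ∀ᶠ y in 𝓝 x, infDist y Ω ≤ κ * infDist (f y) C)
    (hv : v ∈ limitingNormalCone Ω x) :
    ∃ lam ∈ limitingNormalCone C (f x),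
      ContinuousLinearMap.adjoint (fderiv ℝ f x) lam = v ∧ ‖lam‖ ≤ κ * ‖v‖ := by
  obtain ⟨ζ, w, hζ, hw, hmem⟩ := hv
  have hdiff : ∀ᶠ y in 𝓝 x, ContDiffAt ℝ 1 f y := hf.eventually (by simp)
  have hgood : ∀ᶠ y in 𝓝 x, ∀ u ∈ regularNormalCone Ω y, y ∈ Ω →
      ∃ lam ∈ limitingNormalCone C (f y),
        ContinuousLinearMap.adjoint (fderiv ℝ f y) lam = u ∧ ‖lam‖ ≤ κ * ‖u‖ := by
    filter_upwards [hdiff, hΩ, hsub.eventually_nhds,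
      hf.continuousAt.eventually hC.eventually] with y h1 h2 h3 h4 u hu hy
    exact exists_multiplier_of_mem_regularNormalCone hκ hy (h2 hy) h1 h4 h3 hu
  obtain ⟨N, hN⟩ := eventually_atTop.1 (hζ.eventually hgood)
  choose lam hlam hadj hnorm using fun k =>
    hN (k + N) (Nat.le_add_left N k) (w (k + N)) (hmem _).2 (hmem _).1
  have hζ' : Tendsto (fun k => ζ (k + N)) atTop (𝓝 x) := hζ.comp (tendsto_add_atTop_nat N)
  have hw' : Tendsto (fun k => w (k + N)) atTop (𝓝 v) := hw.comp (tendsto_add_atTop_nat N)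
  obtain ⟨M, hM⟩ := hw'.norm.bddAbove_range
  obtain ⟨lam₀, -, φ, hφ, hlam₀⟩ := (isCompact_closedBall (0 : F) (κ * M)).tendsto_subseq
    (x := lam) (fun k => by
      rw [mem_closedBall_zero_iff]
      exact (hnorm k).trans (by gcongr; exact hM ⟨k, rfl⟩))
  have hφ' := hφ.tendsto_atTop
  have hD : Tendsto (fun k => ContinuousLinearMap.adjoint (fderiv ℝ f (ζ (φ k + N)))) atTop
      (𝓝 (ContinuousLinearMap.adjoint (fderiv ℝ f x))) := by
    have h1 : ContinuousAt (fderiv ℝ f) x := (hf.fderiv_right (m := 0) (by simp)).continuousAt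
    exact (ContinuousLinearMap.adjoint.continuous.tendsto _).comp
      (h1.tendsto.comp (hζ'.comp hφ'))
  refine ⟨lam₀, limitingNormalCone_closed_graph
    (hf.continuousAt.tendsto.comp (hζ'.comp hφ')) hlam₀ fun k => hlam (φ k), ?_, ?_⟩
  · refine tendsto_nhds_unique (tendsto_clm_apply hD hlam₀) ((hw'.comp hφ').congr fun k => ?_)
    exact (hadj (φ k)).symm
  · exact le_of_tendsto_of_tendsto' hlam₀.norm ((hw'.comp hφ').norm.const_mul κ)
      fun k => hnorm (φ k)

end Multipliers

end RobinsonStability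
namespace RobinsonStability

/-! ### Extended and real distances -/

section Distances

variable {X Y : Type*} [PseudoMetricSpace X] [PseudoMetricSpace Y]

theorem infDist_le_of_infEDist_le {s : Set X} {t : Set Y} (ht : t.Nonempty) {x : X} {y : Y}
    {κ : ℝ≥0} (h : infEDist x s ≤ κ * infEDist y t) : infDist x s ≤ κ * infDist y t := by
  have := ENNReal.toReal_mono
    (ENNReal.mul_ne_top ENNReal.coe_ne_top (infEDist_ne_top ht)) h
  simpa [infDist, ENNReal.toReal_mul] using this

/-- With κ ≠ 0 the case of empty t is covered too: the right side is then ∞. -/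
theorem infEDist_le_mul_of_forall_dist_le {s : Set X} {t : Set Y} {x z : X} {y : Y} {κ : ℝ≥0}
    (hz : z ∈ s) (hκ : κ ≠ 0) (h : ∀ c ∈ t, dist x z ≤ κ * dist y c) :
    infEDist x s ≤ κ * infEDist y t := by
  refine (infEDist_le_edist_of_mem hz).trans ?_
  rw [mul_comm, ← ENNReal.div_le_iff (by simpa using hκ) ENNReal.coe_ne_top]
  refine le_infEDist.2 fun c hc => ?_
  rw [ENNReal.div_le_iff (by simpa using hκ) ENNReal.coe_ne_top, edist_dist, edist_dist,
    mul_comm, ← ENNReal.ofReal_coe_nnreal, ← ENNReal.ofReal_mul κ.coe_nonneg]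
  exact ENNReal.ofReal_le_ofReal (h c hc)

theorem infEDist_zero_setOf_sub {F : Type*} [SeminormedAddCommGroup F] (C : Set F) (y : F) :
    infEDist 0 {w | ∃ c ∈ C, w = y - c} = infEDist y C := by
  have : {w | ∃ c ∈ C, w = y - c} = (fun c => y - c) '' C := by
    ext w
    simp [eq_comm]
  rw [this]
  simp only [infEDist, iInf_image]
  simp only [edist_dist, dist_eq_norm, zero_sub, norm_neg]

end Distances

/-! ### Linearization with uniform error -/

section Linearization

variable {E F : Type*} [NormedAddCommGroup E] [NormedSpace ℝ E]
  [NormedAddCommGroup F] [NormedSpace ℝ F]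

/-- Comparison with a fixed A makes the error uniform in the parameter, given only continuity of the
derivative at the reference point. -/
theorem norm_sub_sub_fderiv_le_of_norm_fderiv_sub_le {f : E → F} {A : E →L[ℝ] F} {s : Set E}
    {ε : ℝ} (hs : Convex ℝ s) (hf : ∀ x ∈ s, DifferentiableAt ℝ f x)
    (hA : ∀ x ∈ s, ‖fderiv ℝ f x - A‖ ≤ ε / 2) {x y : E} (hx : x ∈ s) (hy : y ∈ s) :
    ‖f y - f x - fderiv ℝ f x (y - x)‖ ≤ ε * ‖y - x‖ := by
  refine hs.norm_image_sub_le_of_norm_fderiv_le' hf (fun z hz => ?_) hx hy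
  have h := norm_sub_le_norm_sub_add_norm_sub (fderiv ℝ f z) A (fderiv ℝ f x)
  have h1 := hA z hz
  have h2 := hA x hx
  rw [norm_sub_rev] at h2
  linarith

theorem norm_sub_le_of_norm_fderiv_sub_le {f : E → F} {A : E →L[ℝ] F} {s : Set E}
    {ε : ℝ} (hs : Convex ℝ s) (hf : ∀ x ∈ s, DifferentiableAt ℝ f x)
    (hA : ∀ x ∈ s, ‖fderiv ℝ f x - A‖ ≤ ε) {x y : E} (hx : x ∈ s) (hy : y ∈ s) :
    ‖f y - f x‖ ≤ (‖A‖ + ε) * ‖y - x‖ := by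
  refine hs.norm_image_sub_le_of_norm_fderiv_le hf (fun z hz => ?_) hx hy
  have h := norm_le_norm_add_norm_sub' (fderiv ℝ f z) A
  have h1 := hA z hz
  linarith

end Linearization

/-! ### Superregularity of subamenable sets -/

section Subamenable

variable {l : ℕ}

/-- Subamenable sets are superregular: normals make almost obtuse angles with nearby secants. -/
theorem SubamenableAt.eventually_inner_le {C : Set (EuclideanSpace ℝ (Fin l))}
    {z : EuclideanSpace ℝ (Fin l)} (h : SubamenableAt C z) {ε : ℝ} (hε : 0 < ε) :
    ∃ ρ > 0, ∀ y ∈ C ∩ ball z ρ, ∀ c ∈ C ∩ ball z ρ, ∀ lam ∈ limitingNormalCone C y,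
      inner ℝ lam (c - y) ≤ ε * ‖lam‖ * ‖c - y‖ := by
  obtain ⟨hz, d, W, q, Q, hW, hzW, hq, hQ, hQc, hCW, κ, U, hU, hsub⟩ := h
  have hqz : q z ∈ Q := (hCW.subset ⟨hz, hzW⟩).2
  have hqat : ∀ y ∈ W, ContDiffAt ℝ 1 q y := fun y hy => hq.contDiffAt (hW.mem_nhds hy)
  set ε' : ℝ := ε / (κ + 1) with hε'
  have hε'0 : 0 < ε' := by positivity
  have hD : ContinuousAt (fderiv ℝ q) z :=
    ((hqat z hzW).fderiv_right (m := 0) (by simp)).continuousAt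
  have hmem : ∀ y ∈ W, y ∈ C → q y ∈ Q := fun y hy hyC => (hCW.subset ⟨hyC, hy⟩).2
  have hmult : ∀ᶠ y in 𝓝 z, infDist y C ≤ κ * infDist (q y) Q := by
    filter_upwards [hU, hW.mem_nhds hzW] with y hyU hyW
    refine infDist_le_of_infEDist_le ⟨_, hqz⟩ ?_
    have h1 := hsub y hyU
    have h2 : {ζ | (0 : EuclideanSpace ℝ (Fin d)) ∈ {w | ζ ∈ W ∧ ∃ c ∈ Q, w = q ζ - c}} ⊆ C := by
      rintro ζ ⟨hζ, c, hc, h0⟩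
      have : q ζ ∈ Q := by rwa [sub_eq_zero.1 h0.symm]
      exact (hCW.superset ⟨hζ, this⟩).1
    have h3 : {w | y ∈ W ∧ ∃ c ∈ Q, w = q y - c} = {w | ∃ c ∈ Q, w = q y - c} := by
      simp [hyW]
    simp only at h1
    rw [h3, infEDist_zero_setOf_sub] at h1
    exact (infEDist_anti h2).trans h1
  obtain ⟨ρ, hρ, hball⟩ := nhds_basis_ball.eventually_iff.1
    (hmult.eventually_nhds.and ((hW.eventually_mem hzW).and
      (hD.eventually (closedBall_mem_nhds _ (half_pos hε'0)))))
  refine ⟨ρ, hρ, fun y hy c hc lam hlam => ?_⟩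
  obtain ⟨hy1, hyW, -⟩ := hball hy.2
  have hQl : LocallyClosedAround Q (q y) := ⟨Set.univ, univ_mem, by simpa using hQ⟩
  -- Locally C is the preimage of Q under q, so lam lifts to a normal μ of Q with ‖μ‖ ≤ κ‖lam‖;
  -- convexity of Q then leaves only the linearization error of q.
  obtain ⟨μ, hμ, hadj, hμn⟩ := exists_multiplier_of_mem_limitingNormalCone κ.coe_nonneg (hqat y hyW)
    (by filter_upwards [hW.mem_nhds hyW] with w hw using hmem w hw) hQl hy1 hlam
  have h1 := inner_le_zero_of_mem_limitingNormalCone_of_convex hQc hμ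
    (hmem c (hball hc.2).2.1 hc.1)
  have h2 := norm_sub_sub_fderiv_le_of_norm_fderiv_sub_le (convex_ball z ρ)
    (fun w hw => (hqat w (hball hw).2.1).differentiableAt (by simp))
    (fun w hw => by simpa [dist_eq_norm] using (hball hw).2.2) hy.2 hc.2
  have h3 : inner ℝ lam (c - y) = inner ℝ μ (q c - q y)
      - inner ℝ μ (q c - q y - fderiv ℝ q y (c - y)) := by
    rw [← inner_sub_right, sub_sub_cancel, ← hadj, ContinuousLinearMap.adjoint_inner_left]
  have h4 := (abs_le.1 (abs_real_inner_le_norm μ (q c - q y - fderiv ℝ q y (c - y)))).1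
  have h5 : ‖μ‖ * ‖q c - q y - fderiv ℝ q y (c - y)‖ ≤ (κ * ‖lam‖) * (ε' * ‖c - y‖) := by
    gcongr
  have h6 : κ * ε' ≤ ε := by
    rw [hε', mul_div_assoc', div_le_iff₀ (by positivity)]
    nlinarith
  have h7 : κ * ε' * (‖lam‖ * ‖c - y‖) ≤ ε * (‖lam‖ * ‖c - y‖) := by gcongr
  linarith

end Subamenable

/-! ### Robinson stability and the bounded multiplier property -/

section Main

variable {P : Type*} [TopologicalSpace P] {n l : ℕ}
  {g : P → EuclideanSpace ℝ (Fin n) → EuclideanSpace ℝ (Fin l)}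
  {C : Set (EuclideanSpace ℝ (Fin l))} {p₀ : P} {x₀ : EuclideanSpace ℝ (Fin n)} {κ : ℝ≥0}

theorem StandingAssumptions.eventually_contDiffAt (hg : StandingAssumptions g p₀ x₀) :
    ∀ᶠ z : P × EuclideanSpace ℝ (Fin n) in 𝓝 p₀ ×ˢ 𝓝 x₀, ContDiffAt ℝ 1 (g z.1) z.2 := by
  obtain ⟨V, hV, U, hU, hxU, h⟩ := hg.contDiff_near
  filter_upwards [prod_mem_prod hV (hU.mem_nhds hxU)] with z hz
  exact (h z.1 hz.1).contDiffAt (hU.mem_nhds hz.2)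

theorem StandingAssumptions.tendsto_map (hg : StandingAssumptions g p₀ x₀) :
    Tendsto (fun z : P × EuclideanSpace ℝ (Fin n) => g z.1 z.2) (𝓝 p₀ ×ˢ 𝓝 x₀)
      (𝓝 (g p₀ x₀)) := by
  simpa [ContinuousAt, nhds_prod_eq] using hg.continuousAt_map

theorem StandingAssumptions.tendsto_deriv (hg : StandingAssumptions g p₀ x₀) :
    Tendsto (fun z : P × EuclideanSpace ℝ (Fin n) => fderiv ℝ (g z.1) z.2) (𝓝 p₀ ×ˢ 𝓝 x₀)
      (𝓝 (fderiv ℝ (g p₀) x₀)) := by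
  simpa [ContinuousAt, nhds_prod_eq] using hg.continuousAt_deriv

/-- At the fixed point `x₀` the residual is at most the distance from `g p x₀` to `g p₀ x₀`, which
tends to 0. -/
theorem RobinsonStableWith.parametricallyStable (hfeas : x₀ ∈ solutionMap g C p₀)
    (hg : StandingAssumptions g p₀ x₀) (h : RobinsonStableWith g C p₀ x₀ κ) :
    ParametricallyStable g C p₀ x₀ := by
  intro U' hU'
  obtain ⟨U, hU, V, hV, hRS⟩ := h
  obtain ⟨r, hr, hrU⟩ := EMetric.mem_nhds_iff.1 hU'
  have hcont : Tendsto (fun p => g p x₀) (𝓝 p₀) (𝓝 (g p₀ x₀)) :=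
    hg.tendsto_map.comp (tendsto_id.prodMk tendsto_const_nhds)
  have hlim : Tendsto (fun p => (κ : ℝ≥0∞) * edist (g p x₀) (g p₀ x₀)) (𝓝 p₀) (𝓝 0) := by
    have h1 : Tendsto (fun p => edist (g p x₀) (g p₀ x₀)) (𝓝 p₀) (𝓝 0) :=
      tendsto_iff_edist_tendsto_0.1 hcont
    simpa using ENNReal.Tendsto.const_mul h1 (Or.inr ENNReal.coe_ne_top)
  have hlt : ∀ᶠ p in 𝓝 p₀, (κ : ℝ≥0∞) * edist (g p x₀) (g p₀ x₀) < r := hlim.eventually_lt_const hr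
  refine ⟨_, inter_mem hV hlt, fun p hp => ?_⟩
  have h0 : infEDist (g p x₀) C ≤ edist (g p x₀) (g p₀ x₀) := infEDist_le_edist_of_mem hfeas
  have h1 : infEDist x₀ (solutionMap g C p) < r := by
    refine ((hRS p hp.1 x₀ (mem_of_mem_nhds hU)).trans ?_).trans_lt hp.2
    gcongr
  obtain ⟨y, hy, hyr⟩ := infEDist_lt_iff.1 h1
  exact ⟨y, hy, hrU (by rwa [Metric.mem_eball, edist_comm])⟩

theorem RobinsonStableWith.partialMSCQ (h : RobinsonStableWith g C p₀ x₀ κ) :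
    PartialMSCQ g C p₀ x₀ := by
  obtain ⟨U, hU, V, hV, hRS⟩ := h
  refine ⟨interior U, interior_mem_nhds.2 hU, V, hV, fun p hp x hx =>
    ⟨κ, U, mem_interior_iff_mem_nhds.1 hx.2, fun ξ hξ => ?_⟩⟩
  rw [infEDist_zero_setOf_sub]
  convert hRS p hp ξ hξ using 2
  ext ζ
  simp [solutionMap, sub_eq_zero, eq_comm]

theorem RobinsonStableWith.partialBMPWith (hfeas : x₀ ∈ solutionMap g C p₀)
    (hC : LocallyClosedAround C (g p₀ x₀)) (hg : StandingAssumptions g p₀ x₀)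
    (h : RobinsonStableWith g C p₀ x₀ κ) : PartialBMPWith g C p₀ x₀ κ := by
  obtain ⟨U, hU, V, hV, hRS⟩ := h
  obtain ⟨a, ha, b, hb, hab⟩ := eventually_prod_iff.1
    (hg.eventually_contDiffAt.and (hg.tendsto_map.eventually hC.eventually))
  refine ⟨_, inter_mem hV ha, _, inter_mem (interior_mem_nhds.2 hU) hb,
    fun p hp x hx v hv => ?_⟩
  obtain ⟨h1, h2⟩ := hab hp.2 hx.2.2
  have hsub : ∀ᶠ y in 𝓝 x, infDist y (solutionMap g C p) ≤ κ * infDist (g p y) C := by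
    filter_upwards [mem_interior_iff_mem_nhds.1 hx.2.1] with y hy
    exact infDist_le_of_infEDist_le (t := C) ⟨g p₀ x₀, hfeas⟩ (hRS p hp.1 y hy)
  obtain ⟨lam, hlam, hadj, hn⟩ := exists_multiplier_of_mem_limitingNormalCone κ.coe_nonneg h1
    (Eventually.of_forall fun y hy => hy) h2 hsub hv
  exact ⟨lam, ⟨hlam, hadj⟩, mem_closedBall_zero_iff.2 hn⟩

/-- The quantitative estimate behind the converse implication, for a fixed parameter. -/
theorem norm_le_of_multiplier {E F : Type*} [NormedAddCommGroup E] [InnerProductSpace ℝ E]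
    [CompleteSpace E] [NormedAddCommGroup F] [InnerProductSpace ℝ F] [CompleteSpace F]
    {f : E → F} {A : E →L[ℝ] F} {x y : E} {c lam : F} {κ κ' ε L : ℝ} (hκ : 0 ≤ κ) (hε : 0 < ε)
    (hεκ : κ * (1 + ε) ≤ κ' * (1 - κ * ε * (1 + L))) (hεL : κ * ε * (1 + L) < 1)
    (hadj : ContinuousLinearMap.adjoint A lam = x - y) (hlam : ‖lam‖ ≤ κ * ‖x - y‖)
    (hlin : ‖f x - f y - A (x - y)‖ ≤ ε * ‖x - y‖) (hLip : ‖f x - f y‖ ≤ L * ‖x - y‖)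
    (hc : inner ℝ lam (c - f y) ≤ ε * ‖lam‖ * ‖c - f y‖) :
    ‖x - y‖ ≤ κ' * ‖f x - c‖ := by
  set m := ‖x - y‖ with hm
  have hm0 : 0 ≤ m := norm_nonneg _
  have h1 : m ^ 2 = inner ℝ lam (A (x - y)) := by
    rw [← ContinuousLinearMap.adjoint_inner_left, hadj, real_inner_self_eq_norm_sq]
  have h2 : inner ℝ lam (A (x - y)) = inner ℝ lam (f x - c) + inner ℝ lam (c - f y)
      - inner ℝ lam (f x - f y - A (x - y)) := by
    rw [← inner_add_right, ← inner_sub_right]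
    congr 1
    abel
  have h3 : inner ℝ lam (f x - c) ≤ ‖lam‖ * ‖f x - c‖ := real_inner_le_norm _ _
  have h4 := (abs_le.1 (abs_real_inner_le_norm lam (f x - f y - A (x - y)))).1
  have h5 : ‖c - f y‖ ≤ ‖f x - c‖ + L * m := by
    have := norm_sub_le_norm_sub_add_norm_sub c (f x) (f y)
    rw [norm_sub_rev c (f x)] at this
    linarith
  have h6 : ‖lam‖ * ‖f x - f y - A (x - y)‖ ≤ ‖lam‖ * (ε * m) := by gcongr
  have h7 : ε * ‖lam‖ * ‖c - f y‖ ≤ ε * ‖lam‖ * (‖f x - c‖ + L * m) := by gcongr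
  -- Collects the residual, superregularity and linearization terms; with ‖lam‖ ≤ κ * m one factor m
  -- cancels, and the remaining m-term is absorbed on the left.
  have h8 : m * m ≤ ‖lam‖ * ((1 + ε) * ‖f x - c‖ + ε * (1 + L) * m) := by nlinarith
  have hL : 0 ≤ (1 + ε) * ‖f x - c‖ + ε * (1 + L) * m := by
    have h9 : ‖f x - f y‖ ≤ L * m := hLip
    have : 0 ≤ ε * (L * m) := mul_nonneg hε.le ((norm_nonneg _).trans h9)
    nlinarith [mul_nonneg hε.le hm0, norm_nonneg (f x - c), mul_nonneg hε.le (norm_nonneg (f x - c))]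
  have h9 : m * m ≤ m * (κ * ((1 + ε) * ‖f x - c‖ + ε * (1 + L) * m)) := by
    calc m * m ≤ ‖lam‖ * ((1 + ε) * ‖f x - c‖ + ε * (1 + L) * m) := h8
      _ ≤ (κ * m) * ((1 + ε) * ‖f x - c‖ + ε * (1 + L) * m) := by gcongr
      _ = _ := by ring
  have hκ' : 0 ≤ κ' := by
    by_contra hneg
    nlinarith [mul_nonneg hκ hε.le, mul_pos_of_neg_of_neg (not_le.1 hneg)
      (show κ * ε * (1 + L) - 1 < 0 by linarith)]
  rcases hm0.eq_or_lt with h0 | hpos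
  · rw [← h0]
    positivity
  · have h10 := le_of_mul_le_mul_left h9 hpos
    have h11 : m * (1 - κ * ε * (1 + L)) ≤ κ' * ‖f x - c‖ * (1 - κ * ε * (1 + L)) := by
      have := mul_le_mul_of_nonneg_right hεκ (norm_nonneg (f x - c))
      linarith
    exact le_of_mul_le_mul_right h11 (by linarith)

/-- At ε = 0 the inequalities read κ < κ' and 0 < 1, so continuity suffices. The constant a + 1 will
be the Lipschitz bound ‖A‖ + 1 of `g p`. -/
theorem exists_pos_small_modulus {κ κ' : ℝ} (h : κ < κ') (a : ℝ) :
    ∃ ε > 0, ε ≤ 1 ∧ κ * (1 + ε) ≤ κ' * (1 - κ * ε * (1 + (a + 1))) ∧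
      κ * ε * (1 + (a + 1)) < 1 := by
  have h1 : ∀ᶠ ε in 𝓝 (0 : ℝ), κ * (1 + ε) < κ' * (1 - κ * ε * (1 + (a + 1))) :=
    ContinuousAt.eventually_lt (by fun_prop) (by fun_prop) (by simpa using h)
  have h2 : ∀ᶠ ε in 𝓝 (0 : ℝ), κ * ε * (1 + (a + 1)) < 1 :=
    ContinuousAt.eventually_lt (by fun_prop) (by fun_prop) (by simp)
  have h3 : ∀ᶠ ε in 𝓝 (0 : ℝ), ε < 1 := gt_mem_nhds one_pos
  obtain ⟨ε, ⟨⟨h4, h5⟩, h6⟩, h7⟩ :=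
    (((h1.and h2).and h3).filter_mono nhdsWithin_le_nhds |>.and
      (self_mem_nhdsWithin (a := (0 : ℝ)) (s := Set.Ioi 0))).exists
  exact ⟨ε, h7, h6.le, h4.le, h5⟩

theorem PartialBMPWith.robinsonStableWith
    (hC : LocallyClosedAround C (g p₀ x₀)) (hg : StandingAssumptions g p₀ x₀)
    (hsub : SubamenableAt C (g p₀ x₀)) (hstab : ParametricallyStable g C p₀ x₀)
    (h : PartialBMPWith g C p₀ x₀ κ) {κ' : ℝ≥0} (hκ : κ < κ') :
    RobinsonStableWith g C p₀ x₀ κ' := by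
  obtain ⟨W, hW, hWcl⟩ := hC
  obtain ⟨V, hV, U, hU, hBMP⟩ := h
  have hκ'0 : (0 : ℝ) < κ' := NNReal.coe_pos.2 (bot_le.trans_lt hκ)
  set A := fderiv ℝ (g p₀) x₀ with hA
  obtain ⟨ε, hε, hε1, hεκ, hεL⟩ := exists_pos_small_modulus (NNReal.coe_lt_coe.2 hκ) ‖A‖
  obtain ⟨ρ, hρ, hreg⟩ := hsub.eventually_inner_le hε
  obtain ⟨a, ha, b, hb, hab⟩ := eventually_prod_iff.1
    ((hg.eventually_contDiffAt.and (hg.tendsto_deriv.eventually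
      (closedBall_mem_nhds A (half_pos hε)))).and
      (hg.tendsto_map.eventually (inter_mem hW (ball_mem_nhds _ (half_pos hρ)))))
  obtain ⟨r₀, hr₀, hball⟩ := nhds_basis_closedBall.eventually_iff.1 (hb.and hU)
  -- The entry κ' * ρ / 2 serves points c at distance at least ρ from `g p₀ x₀`: then dist (g p x) c
  -- ≥ ρ / 2, while dist x y < r / 2.
  set r : ℝ := min r₀ (κ' * ρ / 2) with hr
  have hrpos : 0 < r := by positivity
  have hsubset : closedBall x₀ r ⊆ closedBall x₀ r₀ := closedBall_subset_closedBall (min_le_left _ _)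
  obtain ⟨V', hV', hstab'⟩ := hstab (ball x₀ (r / 4)) (ball_mem_nhds _ (by positivity))
  refine ⟨ball x₀ (r / 4), ball_mem_nhds _ (by positivity), _,
    inter_mem hV (inter_mem hV' ha), fun p ⟨hpV, hpV', hpa⟩ x hx => ?_⟩
  have hgood := fun y (hy : y ∈ closedBall x₀ r) => hab hpa (hball (hsubset hy)).1
  have hgc : ContinuousOn (g p) (closedBall x₀ r) := fun y hy =>
    (hgood y hy).1.1.continuousAt.continuousWithinAt
  -- a nearest feasible point
  have hcompact : IsCompact (closedBall x₀ r ∩ solutionMap g C p) := by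
    have heq : closedBall x₀ r ∩ solutionMap g C p = closedBall x₀ r ∩ g p ⁻¹' (C ∩ W) := by
      ext y
      exact ⟨fun hy => ⟨hy.1, hy.2, (hgood y hy.1).2.1⟩, fun hy => ⟨hy.1, hy.2.1⟩⟩
    rw [heq]
    exact (isCompact_closedBall x₀ r).of_isClosed_subset
      (hgc.preimage_isClosed_of_isClosed isClosed_closedBall hWcl) Set.inter_subset_left
  obtain ⟨xf, hxfΓ, hxf⟩ := hstab' p hpV'
  have hxfr : xf ∈ closedBall x₀ r := ball_subset_closedBall (ball_subset_ball (by linarith) hxf)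
  obtain ⟨y, ⟨hyr, hyΓ⟩, hmin⟩ := hcompact.exists_isMinOn ⟨xf, hxfr, hxfΓ⟩
    (f := fun w => ‖x - w‖) (by fun_prop)
  have hxy : dist x y < r / 2 := by
    have h1 : ‖x - y‖ ≤ ‖x - xf‖ := hmin ⟨hxfr, hxfΓ⟩
    have h2 := dist_triangle_right x xf x₀
    rw [mem_ball] at hx hxf
    rw [dist_eq_norm] at h2 ⊢
    linarith
  -- The radius r / 4 for x and xf puts y in the open ball, so y is locally nearest in the whole
  -- solution set and x - y is a normal there.
  have hyball : y ∈ ball x₀ r := by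
    have h1 := dist_triangle_left y x₀ x
    rw [mem_ball] at hx ⊢
    linarith
  have hxr : x ∈ closedBall x₀ r := ball_subset_closedBall (ball_subset_ball (by linarith) hx)
  have hnormal : x - y ∈ limitingNormalCone (solutionMap g C p) y := by
    refine regularNormalCone_subset_limitingNormalCone hyΓ
      (sub_mem_regularNormalCone_of_isLocalMinOn_norm ?_)
    filter_upwards [self_mem_nhdsWithin,
      mem_nhdsWithin_of_mem_nhds (closedBall_mem_nhds_of_mem hyball)] with w hw1 hw2
    exact hmin ⟨hw2, hw1⟩
  obtain ⟨lam, ⟨hlam, hadj⟩, hlamn⟩ := hBMP p hpV y ⟨hyΓ, (hball (hsubset hyr)).2⟩ _ hnormal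
  rw [mem_closedBall_zero_iff] at hlamn
  have hdiff : ∀ w ∈ closedBall x₀ r, DifferentiableAt ℝ (g p) w := fun w hw =>
    (hgood w hw).1.1.differentiableAt (by simp)
  have hder : ∀ w ∈ closedBall x₀ r, ‖fderiv ℝ (g p) w - A‖ ≤ ε / 2 := fun w hw => by
    rw [← dist_eq_norm]
    exact (hgood w hw).1.2
  refine infEDist_le_mul_of_forall_dist_le hyΓ (by exact_mod_cast hκ'0.ne') fun c hc => ?_
  rw [dist_eq_norm x, dist_eq_norm (g p x)]
  -- Superregularity controls only c near `g p₀ x₀`; for distant c the residual is already large.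
  by_cases hcρ : c ∈ ball (g p₀ x₀) ρ
  · refine norm_le_of_multiplier κ.coe_nonneg hε hεκ hεL hadj hlamn
      (norm_sub_sub_fderiv_le_of_norm_fderiv_sub_le (convex_closedBall x₀ r) hdiff hder hyr hxr)
      (norm_sub_le_of_norm_fderiv_sub_le (convex_closedBall x₀ r) hdiff
        (fun w hw => (hder w hw).trans (by linarith)) hyr hxr)
      (hreg _ ⟨hyΓ, ball_subset_ball (by linarith) (hgood y hyr).2.2⟩ c ⟨hc, hcρ⟩ lam hlam)
  · have h1 := (hgood x hxr).2.2
    rw [mem_ball, not_lt] at hcρ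
    rw [mem_ball] at h1
    have h2 := dist_triangle_left c (g p₀ x₀) (g p x)
    rw [← dist_eq_norm, ← dist_eq_norm]
    have h3 : r ≤ κ' * ρ / 2 := min_le_right _ _
    have h4 : κ' * (ρ / 2) ≤ κ' * dist (g p x) c := by
      gcongr
      linarith
    linarith

theorem bmpBound_le_subregBound (hfeas : x₀ ∈ solutionMap g C p₀)
    (hC : LocallyClosedAround C (g p₀ x₀)) (hg : StandingAssumptions g p₀ x₀) :
    bmpBound g C p₀ x₀ ≤ subregBound g C p₀ x₀ :=
  le_iInf₂ fun κ hκ => iInf₂_le κ (hκ.partialBMPWith hfeas hC hg)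

/-- Each BMP modulus κ yields the Robinson modulus κ + η for every η > 0. -/
theorem subregBound_le_bmpBound (hC : LocallyClosedAround C (g p₀ x₀))
    (hg : StandingAssumptions g p₀ x₀) (hsub : SubamenableAt C (g p₀ x₀))
    (hstab : ParametricallyStable g C p₀ x₀) :
    subregBound g C p₀ x₀ ≤ bmpBound g C p₀ x₀ := by
  refine le_iInf₂ fun κ hκ => ENNReal.le_of_forall_pos_le_add fun η hη _ => ?_
  rw [← ENNReal.coe_add]
  exact iInf₂_le (κ + η) (hκ.robinsonStableWith hC hg hsub hstab (lt_add_of_pos_right κ hη))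

end Main

end RobinsonStability

theorem theorem3p3 {P : Type*} [TopologicalSpace P] {n l : ℕ}
    (g : P → EuclideanSpace ℝ (Fin n) → EuclideanSpace ℝ (Fin l))
    (C : Set (EuclideanSpace ℝ (Fin l)))
    (p₀ : P) (x₀ : EuclideanSpace ℝ (Fin n))
    (hfeas : x₀ ∈ RobinsonStability.solutionMap g C p₀)
    (hC : RobinsonStability.LocallyClosedAround C (g p₀ x₀))
    (hg : RobinsonStability.StandingAssumptions g p₀ x₀) :
    (RobinsonStability.RobinsonStable g C p₀ x₀ →
      (RobinsonStability.ParametricallyStable g C p₀ x₀ ∧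
        RobinsonStability.PartialMSCQ g C p₀ x₀ ∧
        RobinsonStability.PartialBMP g C p₀ x₀) ∧
      RobinsonStability.bmpBound g C p₀ x₀ ≤ RobinsonStability.subregBound g C p₀ x₀) ∧
    (RobinsonStability.SubamenableAt C (g p₀ x₀) →
      (RobinsonStability.ParametricallyStable g C p₀ x₀ ∧
        RobinsonStability.PartialMSCQ g C p₀ x₀ ∧
        RobinsonStability.PartialBMP g C p₀ x₀) →
      RobinsonStability.RobinsonStable g C p₀ x₀ ∧
      RobinsonStability.subregBound g C p₀ x₀ = RobinsonStability.bmpBound g C p₀ x₀) := by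
  refine ⟨fun ⟨κ, hκ⟩ => ⟨⟨hκ.parametricallyStable hfeas hg, hκ.partialMSCQ, κ,
    hκ.partialBMPWith hfeas hC hg⟩, RobinsonStability.bmpBound_le_subregBound hfeas hC hg⟩,
    fun hsub ⟨hstab, _, κ, hκ⟩ =>
      ⟨⟨κ + 1, hκ.robinsonStableWith hC hg hsub hstab (lt_add_of_pos_right κ one_pos)⟩, ?_⟩⟩
  exact le_antisymm (RobinsonStability.subregBound_le_bmpBound hC hg hsub hstab)
    (RobinsonStability.bmpBound_le_subregBound hfeas hC hg)
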